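/- Let $\mathfrak h_4$ be the complex Lie algebra with basis $E,F,I,J$ and nonzero brackets $[E,F]=I$, $[J,E]=E$, $[J,F]=-F$, with the invariant symmetric bilinear form $\kappa$ given by $\kappa(E,F)=\kappa(I,J)=1$ and all other entries $0$. Let $\widehat{\mathfrak h}_4=\mathfrak h_4\otimes\mathbb C[t,t^{-1}]\oplus\mathbb C K$ with $[A_m,B_n]=[A,B]_{m+n}+m\,\kappa(A,B)\,\delta_{m+n,0}K$ and $K$ central, where $A_n=A\otimes t^n$. Put $Q=FE+IJ\in U(\mathfrak h_4)$. For $i,j,h\in\mathbb C$, let $\overline{\mathcal R}_{i,j;h}$ be the dense $\mathfrak h_4$-module induced from the one-dimensional $\mathbb C[I,J,Q]$-module on which $I,J,Q$ act as $i,j,h$, and let $\mathcal R_{i,j;h}$ be the level-$1$ $\widehat{\mathfrak h}_4$-module induced from it (the $A_n$ with $n>0$ acting on $\overline{\mathcal R}_{i,j;h}$ as $0$, $A_0$ as $A$, and $K$ as the identity). Let $L_0$ be the zero mode of $T={:}EF{:}+{:}IJ{:}-\tfrac12\partial I-\tfrac12{:}II{:}$. The ground states of $\mathcal R_{i,j;h}$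 are its vectors of minimal conformal weight, that is, of $L_0$-eigenvalue $h+i\left(\tfrac12-\tfrac i2\right)$. Let $\mathcal E_{i,j;h}$ be the quotient of $\mathcal R_{i,j;h}$ by the sum of all its submodules that have zero intersection with the space of ground states. Suppose $i\neq0$. If $j\in h/i+\mathbb Z_{>0}$, then $\overline{\mathcal R}_{i,j;h}$ is reducible and has a highest-weight vector, of $J$-eigenvalue $h/i$; for such $j$ write $\mathcal R^+_{i;h}$ for $\mathcal R_{i,j;h}$ and $\mathcal E^+_{i;h}$ for $\mathcal E_{i,j;h}$. If $j\in h/i-\mathbb Z_{\ge0}$, then $\overline{\mathcal R}_{i,j;h}$ is reducible and has a lowest-weight vector, of $J$-eigenvalue $h/i+1$; for such $j$ write $\mathcal R^-_{i;h}$ for $\mathcal R_{i,j;h}$ and $\mathcal E^-_{i;h}$ for $\mathcal E_{i,j;h}$. (Up to isomorphism, these modules do not depend on the choice of such $j$.) Then, for all $i\in\mathbb C\setminus\mathbb Z$ and all $h\in\mathbb C$, there are isomorphisms of $\widehat{\mathfrak h}_4$-modules $$\mathcal E^{+}_{i;h}\cong\mathcal R^{+}_{i;h}\qquad\text{and}\qquad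 \mathcal E^{-}_{i;h}\cong\mathcal R^{-}_{i;h}$$ (for every admissible choice of $j$ in either case). -/

import Mathlib

open scoped TensorProduct

noncomputable section

namespace NappiWitten

/-! ### The Lie algebra `𝔥₄` -/

/-- The underlying space of the four-dimensional complex Lie algebra `𝔥₄`; the coordinates `0, 1, 2, 3`
are those with respect to the basis `E, F, I, J`. -/
def H4 : Type := Fin 4 → ℂ

namespace H4

instance : AddCommGroup H4 := inferInstanceAs (AddCommGroup (Fin 4 → ℂ))
instance : Module ℂ H4 := inferInstanceAs (Module ℂ (Fin 4 → ℂ))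

@[ext] theorem ext {x y : H4} (h0 : x 0 = y 0) (h1 : x 1 = y 1) (h2 : x 2 = y 2) (h3 : x 3 = y 3) :
    x = y := by
  funext k
  fin_cases k
  · exact h0
  · exact h1
  · exact h2
  · exact h3

@[simp] theorem add_apply (x y : H4) (k : Fin 4) : (x + y) k = x k + y k := rfl
@[simp] theorem zero_apply (k : Fin 4) : (0 : H4) k = 0 := rfl
@[simp] theorem neg_apply (x : H4) (k : Fin 4) : (-x) k = -x k := rfl
@[simp] theorem smul_apply (c : ℂ) (x : H4) (k : Fin 4) : (c • x) k = c * x k := rfl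

/-- The basis vector `E`. -/
def E : H4 := (![1, 0, 0, 0] : Fin 4 → ℂ)
/-- The basis vector `F`. -/
def F : H4 := (![0, 1, 0, 0] : Fin 4 → ℂ)
/-- The basis vector `I`. -/
def I : H4 := (![0, 0, 1, 0] : Fin 4 → ℂ)
/-- The basis vector `J`. -/
def J : H4 := (![0, 0, 0, 1] : Fin 4 → ℂ)

/-- The bracket with `[E,F] = I`, `[J,E] = E`, `[J,F] = -F` and `I` central. -/
instance : Bracket H4 H4 where
  bracket x y :=
    (![x 3 * y 0 - x 0 * y 3, x 1 * y 3 - x 3 * y 1, x 0 * y 1 - x 1 * y 0, 0] : Fin 4 → ℂ)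

@[simp] theorem lie_apply_zero (x y : H4) : ⁅x, y⁆ 0 = x 3 * y 0 - x 0 * y 3 := rfl
@[simp] theorem lie_apply_one (x y : H4) : ⁅x, y⁆ 1 = x 1 * y 3 - x 3 * y 1 := rfl
@[simp] theorem lie_apply_two (x y : H4) : ⁅x, y⁆ 2 = x 0 * y 1 - x 1 * y 0 := rfl
@[simp] theorem lie_apply_three (x y : H4) : ⁅x, y⁆ 3 = 0 := rfl

instance : LieRing H4 where
  add_lie x y z := by ext <;> simp <;> ring
  lie_add x y z := by ext <;> simp <;> ring
  lie_self x := by ext <;> simp <;> ring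
  leibniz_lie x y z := by ext <;> simp <;> ring

instance : LieAlgebra ℂ H4 where
  lie_smul c x y := by ext <;> simp <;> ring

theorem lie_E_F : ⁅E, F⁆ = I := by ext <;> simp <;> simp [E, F, I]
theorem lie_J_E : ⁅J, E⁆ = E := by ext <;> simp <;> simp [J, E]
theorem lie_J_F : ⁅J, F⁆ = -F := by ext <;> simp <;> simp [J, F]
theorem lie_I (x : H4) : ⁅I, x⁆ = 0 := by ext <;> simp <;> simp [I]

/-- The invariant symmetric bilinear form with `κ(E,F) = κ(I,J) = 1` and all other entries `0`. -/
def form : LinearMap.BilinForm ℂ H4 :=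
  LinearMap.mk₂ ℂ (fun x y => x 0 * y 1 + x 1 * y 0 + x 2 * y 3 + x 3 * y 2)
    (fun x y z => by simp; ring) (fun c x y => by simp; ring)
    (fun x y z => by simp; ring) (fun c x y => by simp; ring)

theorem form_apply (x y : H4) :
    form x y = x 0 * y 1 + x 1 * y 0 + x 2 * y 3 + x 3 * y 2 := rfl

theorem form_isSymm : form.IsSymm := ⟨fun x y => by simp [form_apply]; ring⟩

theorem form_lieInvariant : form.lieInvariant H4 := fun x y z => by
  simp [form_apply]; ring

end H4

/-- The universal enveloping algebra `U(𝔥₄)`. -/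
abbrev UH4 : Type := UniversalEnvelopingAlgebra ℂ H4

/-- The canonical inclusion `𝔥₄ → U(𝔥₄)`. -/
abbrev toUH4 (A : H4) : UH4 := UniversalEnvelopingAlgebra.ι ℂ A

/-- The quadratic Casimir element `Q = FE + IJ`. -/
def casimir : UH4 := toUH4 H4.F * toUH4 H4.E + toUH4 H4.I * toUH4 H4.J

/-- The left ideal of `U(𝔥₄)` generated by `I - i`, `J - j` and `Q - h`. -/
def denseIdeal (i j h : ℂ) : Submodule UH4 UH4 :=
  Submodule.span UH4
    {toUH4 H4.I - algebraMap ℂ UH4 i, toUH4 H4.J - algebraMap ℂ UH4 j,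
      casimir - algebraMap ℂ UH4 h}

/-- The dense `𝔥₄`-module `R̄_{i,j;h}`, induced from the one-dimensional module of the subalgebra
`ℂ[I, J, Q]` of `U(𝔥₄)` on which `I`, `J`, `Q` act by `i`, `j`, `h`. -/
abbrev DenseModule (i j h : ℂ) : Type := UH4 ⧸ denseIdeal i j h

/-! ### The affine Lie algebra -/

/-- The two-cocycle `(A ⊗ tᵐ, B ⊗ tⁿ) ↦ n κ(A,B) δ_{m+n,0}` on the loop algebra of `𝔥₄`. -/
abbrev affineCocycle :=
  LieAlgebra.LoopAlgebra.twoCocycleOfBilinear ℂ ℤ H4 H4.form H4.form_lieInvariant H4.form_isSymm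

/-- The affine Lie algebra `𝔥₄ ⊗ ℂ[t,t⁻¹] ⊕ ℂ K`. -/
abbrev AffineH4 : Type := LieAlgebra.ofTwoCocycle affineCocycle

/-- The element `A_n = A ⊗ tⁿ` of the affine algebra. -/
def mode (A : H4) (n : ℤ) : AffineH4 :=
  LieAlgebra.ofProd affineCocycle (AddMonoidAlgebra.single n (1 : ℂ) ⊗ₜ[ℂ] A, 0)

/-- The central element `K`. The sign turns the cocycle `n κ(A,B) δ_{m+n,0}` into the usual
`m κ(A,B) δ_{m+n,0}`, see `mode_lie_mode`. -/
def central : AffineH4 :=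
  LieAlgebra.ofProd affineCocycle
    (0, (TrivialLieModule.equiv ℂ (LieAlgebra.loopAlgebra ℂ ℤ H4) ℂ).symm (-1))

theorem affineCocycle_single (A B : H4) (m n : ℤ) :
    TrivialLieModule.equiv ℂ (LieAlgebra.loopAlgebra ℂ ℤ H4) ℂ
      ((affineCocycle : LieAlgebra.loopAlgebra ℂ ℤ H4 →ₗ[ℂ] LieAlgebra.loopAlgebra ℂ ℤ H4 →ₗ[ℂ] _)
        (AddMonoidAlgebra.single m (1 : ℂ) ⊗ₜ[ℂ] A) (AddMonoidAlgebra.single n (1 : ℂ) ⊗ₜ[ℂ] B)) =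
      if m + n = 0 then (n : ℂ) * H4.form A B else 0 := by
  have key : LieAlgebra.LoopAlgebra.residuePairing ℂ ℤ H4 H4.form
      (AddMonoidAlgebra.single m (1 : ℂ) ⊗ₜ[ℂ] A) (AddMonoidAlgebra.single n (1 : ℂ) ⊗ₜ[ℂ] B) =
      if m + n = 0 then (n : ℂ) * H4.form A B else 0 := by
    rw [LieAlgebra.LoopAlgebra.residuePairing_apply_apply,
      LieAlgebra.LoopAlgebra.toFinsupp_single_tmul, LieAlgebra.LoopAlgebra.toFinsupp_single_tmul,
      Finsupp.sum_single_index (by simp)]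
    split_ifs with h
    · rw [show -n = m by omega, Finsupp.single_eq_same, zsmul_eq_mul]
    · rw [Finsupp.single_eq_of_ne (by omega), map_zero, LinearMap.zero_apply, smul_zero]
  exact key

theorem mode_lie_mode (A B : H4) (m n : ℤ) :
    ⁅mode A m, mode B n⁆ =
      mode ⁅A, B⁆ (m + n) + (if m + n = 0 then (m : ℂ) * H4.form A B else 0) • central := by
  have h1 : ⁅(AddMonoidAlgebra.single m (1 : ℂ) ⊗ₜ[ℂ] A : LieAlgebra.loopAlgebra ℂ ℤ H4),
      (AddMonoidAlgebra.single n (1 : ℂ) ⊗ₜ[ℂ] B : LieAlgebra.loopAlgebra ℂ ℤ H4)⁆ =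
      AddMonoidAlgebra.single (m + n) (1 : ℂ) ⊗ₜ[ℂ] ⁅A, B⁆ := by
    rw [LieAlgebra.ExtendScalars.bracket_tmul, AddMonoidAlgebra.single_mul_single, one_mul]
  rw [mode, mode, mode, central, LieAlgebra.bracket_ofTwoCocycle, ← LieAlgebra.of_smul,
    ← LieAlgebra.of_add]
  refine congrArg _ (Prod.ext ?_ ?_)
  · simp only [Equiv.symm_apply_apply, h1, Prod.fst_add, Prod.smul_fst, smul_zero, add_zero]
  · apply (TrivialLieModule.equiv ℂ (LieAlgebra.loopAlgebra ℂ ℤ H4) ℂ).injective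
    simp only [Equiv.symm_apply_apply, lie_zero, add_zero, sub_zero, Prod.snd_add, Prod.smul_snd,
      zero_add, map_smul, LinearEquiv.apply_symm_apply]
    rw [affineCocycle_single]
    split_ifs with h
    · rw [show n = -m by omega]
      push_cast
      simp
    · simp

theorem mode_lie_central (A : H4) (m : ℤ) : ⁅mode A m, central⁆ = 0 := by
  rw [mode, central, LieAlgebra.bracket_ofTwoCocycle, ← LieAlgebra.of_zero]
  refine congrArg _ (Prod.ext ?_ ?_)
  · simp only [Equiv.symm_apply_apply, lie_zero, Prod.fst_zero]
  · simp only [Equiv.symm_apply_apply, map_zero, zero_lie, sub_zero, zero_add, Prod.snd_zero]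
    exact LieModule.IsTrivial.trivial _ _

/-- The universal enveloping algebra of the affine algebra. Modules over the affine algebra are
treated as modules over this ring. -/
abbrev UAffine : Type := UniversalEnvelopingAlgebra ℂ AffineH4

/-- `A_n` as an element of the enveloping algebra. -/
def modeU (A : H4) (n : ℤ) : UAffine := UniversalEnvelopingAlgebra.ι ℂ (mode A n)

/-- `K` as an element of the enveloping algebra. -/
def centralU : UAffine := UniversalEnvelopingAlgebra.ι ℂ central

/-! ### Induction from `𝔥₄` to the affine algebra at level one -/

section Induction

variable (M : Type) [AddCommGroup M] [Module ℂ M] [Module UH4 M]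

/-- The relations `p ⊗ m = 1 ⊗ p m`, where `p` runs over the spanning vectors `A_0`, `A_n` with
`n > 0`, and `K` of the subalgebra from which one induces, and `M` carries its `𝔥₄`-action for
`A_0`, the zero action of `A_n`, `n > 0`, and the identity action of `K`. -/
def inductionRelations : Submodule UAffine (UAffine ⊗[ℂ] M) :=
  Submodule.span UAffine
    ({x | ∃ (A : H4) (m : M), x = modeU A 0 ⊗ₜ[ℂ] m - 1 ⊗ₜ[ℂ] (toUH4 A • m)} ∪
      {x | ∃ (A : H4) (n : ℤ) (m : M), 0 < n ∧ x = modeU A n ⊗ₜ[ℂ] m} ∪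
      {x | ∃ m : M, x = centralU ⊗ₜ[ℂ] m - 1 ⊗ₜ[ℂ] m})

/-- The level-one module over the affine algebra induced from the `𝔥₄`-module `M`, that is, the
tensor product of `U` of the affine algebra with `M` over `U` of the subalgebra of the nonnegative
modes and `K`. -/
abbrev Induced : Type := (UAffine ⊗[ℂ] M) ⧸ inductionRelations M

end Induction

/-! ### Conformal weights -/

section ConformalWeight

variable {W : Type} [AddCommGroup W] [Module UAffine W]

/-- The `n`-th summand (`n > 0`) of the normally ordered expression for `L₀`. -/
def sugawaraTerm (n : ℤ) : UAffine :=
  modeU H4.E (-n) * modeU H4.F n + modeU H4.F (-n) * modeU H4.E n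
    + modeU H4.I (-n) * modeU H4.J n + modeU H4.J (-n) * modeU H4.I n
    - modeU H4.I (-n) * modeU H4.I n

/-- The part of `L₀` that is made from zero modes: `F₀E₀ + I₀J₀ + I₀/2 - I₀²/2`. -/
def sugawaraZero : UAffine :=
  modeU H4.F 0 * modeU H4.E 0 + modeU H4.I 0 * modeU H4.J 0
    + algebraMap ℂ UAffine (1 / 2) * (modeU H4.I 0 - modeU H4.I 0 * modeU H4.I 0)

/-- The Virasoro zero mode `L₀` of the conformal vector
`T = :EF: + :IJ: - ∂I/2 - :II:/2` at level one, acting on a module on which each vector is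
annihilated by all `A_n` with `n` large (so that only finitely many summands act nontrivially on
a given vector), such as an induced module. -/
def virasoroZero (v : W) : W :=
  sugawaraZero • v + ∑ᶠ n : ℕ, sugawaraTerm (n + 1) • v

/-- The vectors of conformal weight `Δ`. -/
def conformalWeightSpace (W : Type) [AddCommGroup W] [Module UAffine W] (Δ : ℂ) : Set W :=
  {v | virasoroZero v = algebraMap ℂ UAffine Δ • v}

end ConformalWeight

/-! ### The relaxed modules and their quotients -/

/-- The conformal weight `h + i (1/2 - i/2)` of the relaxed highest-weight vectors of
`I₀`-eigenvalue `i` and `Q₀`-eigenvalue `h`. -/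
def minimalWeight (i h : ℂ) : ℂ := h + i * (1 / 2 - i / 2)

/-- The relaxed module `R_{i,j;h}` over the affine algebra at level one, induced from `R̄_{i,j;h}`. -/
abbrev RelaxedModule (i j h : ℂ) : Type := Induced (DenseModule i j h)

/-- The space of ground states of `R_{i,j;h}`: the vectors of minimal conformal weight. -/
def groundStates (i j h : ℂ) : Set (RelaxedModule i j h) :=
  conformalWeightSpace (RelaxedModule i j h) (minimalWeight i h)

/-- The sum of all submodules of `R_{i,j;h}` that have zero intersection with the space of ground
states. -/
def groundFreeSubmodule (i j h : ℂ) : Submodule UAffine (RelaxedModule i j h) :=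
  sSup {N | ∀ v ∈ N, v ∈ groundStates i j h → v = 0}

/-- The quotient `E_{i,j;h}` of `R_{i,j;h}` by the sum of all submodules that have zero intersection
with the space of ground states. -/
abbrev QuotientModule (i j h : ℂ) : Type := RelaxedModule i j h ⧸ groundFreeSubmodule i j h

end NappiWitten

end

/-!
For `i ∉ ℤ` every nonzero submodule of `R_{i,j;h}` contains a nonzero ground state, for any `j`
(`groundFreeSubmodule_eq_bot`). Hence the submodule to be divided out is zero.

Let `G` be the copy of the dense module in `R_{i,j;h}`; it consists of ground states. The positive
modes lower the degree, so a nonzero submodule contains a nonzero vector annihilated by all of them,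
and it is enough that such singular vectors lie in `G` (`ModeAction.mem_G_of_singular`). In terms of
free fields, multiplying `E(z)` and `F(z)` by `exp (∓ ∫ I)` turns them into a pair of free bosons with
modes shifted by `i`, whose commutators `[E_n, F_{-n}] = n + i` are all nonzero when `i ∉ ℤ`; a Fock
space of such bosons has no singular vectors besides its ground states. The proof below replaces the
exponentials by filtrations on which truncated number operators act by a scalar up to lower-order
terms. These operators end in positive modes, so they annihilate singular vectors.

* `∑ n⁻¹ J_{-n} I_n` counts the modes `J_{-n}`, so a singular vector involves none
  (`ModeAction.mem_currents_of_I_eq_zero`).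
* Modulo vectors that involve a mode `I_{-n}`, one has `[E_m, F_n] = (m + i) δ_{m+n,0}`. There
  `∑ (n / (n + i) F_{-n} E_n + n / (n - i) E_{-n} F_n)` measures the degree, so a singular vector is
  the sum of an element of `G` and a vector that involves a mode `I_{-n}`
  (`ModeAction.mem_G_sup_of_mem_currents`).
* Modulo vectors that involve more modes `I_{-n}`, the operator `∑ n⁻¹ I_{-n} J_n` counts these
  modes. A singular vector that involves at least one of them therefore involves arbitrarily many, and
  it vanishes because its degree is bounded (`ModeAction.eq_zero_of_mem_currents_one`).

The filtrations are defined by spanning vectors and are only bounded from above, so that no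
Poincaré–Birkhoff–Witt theorem is needed.
-/

noncomputable section

namespace NappiWitten

/-! ### Spaces with an action of modes -/

/-- The operators `E_n, F_n, I_n, J_n` of a level-one module of the affine algebra on which `I_0`
acts as the scalar `i`, together with a subspace `G` that is stable under the zero modes and
annihilated by the positive modes. -/
structure ModeAction (i : ℂ) (V : Type*) [AddCommGroup V] [Module ℂ V] where
  E : ℤ → V →ₗ[ℂ] V
  F : ℤ → V →ₗ[ℂ] V
  I : ℤ → V →ₗ[ℂ] V
  J : ℤ → V →ₗ[ℂ] V
  G : Submodule ℂ V
  E_E (m n : ℤ) (x : V) : E m (E n x) = E n (E m x)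
  F_F (m n : ℤ) (x : V) : F m (F n x) = F n (F m x)
  E_F (m n : ℤ) (x : V) :
    E m (F n x) = F n (E m x) + I (m + n) x + (if m + n = 0 then (m : ℂ) else 0) • x
  I_E (m n : ℤ) (x : V) : I m (E n x) = E n (I m x)
  I_F (m n : ℤ) (x : V) : I m (F n x) = F n (I m x)
  I_I (m n : ℤ) (x : V) : I m (I n x) = I n (I m x)
  J_E (m n : ℤ) (x : V) : J m (E n x) = E n (J m x) + E (m + n) x
  J_F (m n : ℤ) (x : V) : J m (F n x) = F n (J m x) - F (m + n) x
  J_I (m n : ℤ) (x : V) : J m (I n x) = I n (J m x) + (if m + n = 0 then (m : ℂ) else 0) • x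
  J_J (m n : ℤ) (x : V) : J m (J n x) = J n (J m x)
  I_zero (x : V) : I 0 x = i • x
  E_pos (n : ℤ) (hn : 0 < n) (x : V) (hx : x ∈ G) : E n x = 0
  F_pos (n : ℤ) (hn : 0 < n) (x : V) (hx : x ∈ G) : F n x = 0
  I_pos (n : ℤ) (hn : 0 < n) (x : V) (hx : x ∈ G) : I n x = 0
  J_pos (n : ℤ) (hn : 0 < n) (x : V) (hx : x ∈ G) : J n x = 0
  E_zero (x : V) (hx : x ∈ G) : E 0 x ∈ G
  F_zero (x : V) (hx : x ∈ G) : F 0 x ∈ G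
  J_zero (x : V) (hx : x ∈ G) : J 0 x ∈ G

namespace ModeAction

variable {i : ℂ} {V : Type*} [AddCommGroup V] [Module ℂ V] (M : ModeAction i V)

/-- `IsCurrent l d x`: the vector `x` is a combination of vectors obtained from `G` by applying
modes `E_{-n}, F_{-n}, I_{-n}` with `n > 0`, at least `l` of them of type `I`, of total degree at
most `d`. -/
inductive IsCurrent : ℕ → ℤ → V → Prop
  | zero (l d) : IsCurrent l d 0
  | add {l d x y} : IsCurrent l d x → IsCurrent l d y → IsCurrent l d (x + y)
  | smul {l d x} (c : ℂ) : IsCurrent l d x → IsCurrent l d (c • x)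
  | ground {x} : x ∈ M.G → IsCurrent 0 0 x
  | E {l d x} (n : ℤ) : 0 < n → IsCurrent l d x → IsCurrent l (d + n) (M.E (-n) x)
  | F {l d x} (n : ℤ) : 0 < n → IsCurrent l d x → IsCurrent l (d + n) (M.F (-n) x)
  | I {l d x} (n : ℤ) : 0 < n → IsCurrent l d x → IsCurrent (l + 1) (d + n) (M.I (-n) x)
  | weaken {l d x} : IsCurrent (l + 1) d x → IsCurrent l d x
  | raise {l d x} : IsCurrent l d x → IsCurrent l (d + 1) x

/-- The subspace of the vectors satisfying `IsCurrent l d`. -/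
def currents (l : ℕ) (d : ℤ) : Submodule ℂ V where
  carrier := {x | M.IsCurrent l d x}
  zero_mem' := .zero l d
  add_mem' := .add
  smul_mem' c _ := .smul c

theorem currents_anti {l l' : ℕ} (h : l ≤ l') (d : ℤ) : M.currents l' d ≤ M.currents l d := by
  induction h with
  | refl => exact le_rfl
  | step _ ih => exact fun x hx => ih (IsCurrent.weaken hx)

theorem currents_mono (l : ℕ) {d d' : ℤ} (h : d ≤ d') : M.currents l d ≤ M.currents l d' := by
  obtain ⟨k, rfl⟩ := Int.le.dest h
  induction k with
  | zero => simp
  | succ k ih =>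
    intro x hx
    have := IsCurrent.raise (ih (by omega) hx)
    rwa [add_assoc] at this

theorem E_neg_mem {l : ℕ} {d : ℤ} {x : V} {m : ℤ} (hm : m < 0) (hx : x ∈ M.currents l d) :
    M.E m x ∈ M.currents l (d - m) := by
  have h := IsCurrent.E (-m) (by omega) hx
  rwa [neg_neg, ← sub_eq_add_neg] at h

theorem F_neg_mem {l : ℕ} {d : ℤ} {x : V} {m : ℤ} (hm : m < 0) (hx : x ∈ M.currents l d) :
    M.F m x ∈ M.currents l (d - m) := by
  have h := IsCurrent.F (-m) (by omega) hx
  rwa [neg_neg, ← sub_eq_add_neg] at h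

theorem I_neg_mem {l : ℕ} {d : ℤ} {x : V} {m : ℤ} (hm : m < 0) (hx : x ∈ M.currents l d) :
    M.I m x ∈ M.currents (l + 1) (d - m) := by
  have h := IsCurrent.I (-m) (by omega) hx
  rwa [neg_neg, ← sub_eq_add_neg] at h

/-- Each mode of type `I` costs at least one unit of degree. -/
theorem eq_zero_of_mem_currents {l : ℕ} {d : ℤ} {x : V} (hx : x ∈ M.currents l d) (h : d < l) :
    x = 0 := by
  induction hx with
  | zero => rfl
  | add _ _ h₁ h₂ => rw [h₁ h, h₂ h, add_zero]
  | smul c _ h₁ => rw [h₁ h, smul_zero]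
  | ground _ => simp at h
  | E n hn _ h₁ => rw [h₁ (by omega), map_zero]
  | F n hn _ h₁ => rw [h₁ (by omega), map_zero]
  | I n hn _ h₁ => rw [h₁ (by push_cast at h; omega), map_zero]
  | weaken _ h₁ => exact h₁ (by push_cast; omega)
  | raise _ h₁ => exact h₁ (by omega)

theorem mem_G_of_mem_currents {l : ℕ} {d : ℤ} {x : V} (hx : x ∈ M.currents l d) (h : d ≤ 0) :
    x ∈ M.G := by
  induction hx with
  | zero => exact zero_mem _
  | add _ _ h₁ h₂ => exact add_mem (h₁ h) (h₂ h)
  | smul c _ h₁ => exact M.G.smul_mem c (h₁ h)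
  | ground hx => exact hx
  | E n hn hx _ => rw [M.eq_zero_of_mem_currents hx (by omega), map_zero]; exact zero_mem _
  | F n hn hx _ => rw [M.eq_zero_of_mem_currents hx (by omega), map_zero]; exact zero_mem _
  | I n hn hx _ => rw [M.eq_zero_of_mem_currents hx (by omega), map_zero]; exact zero_mem _
  | weaken _ h₁ => exact h₁ h
  | raise _ h₁ => exact h₁ (by omega)

/-- Without modes of type `J`, the modes `I_m` with `m > 0` have nothing to be paired with. -/
theorem I_pos_eq_zero {l : ℕ} {d : ℤ} {x : V} {m : ℤ} (hm : 0 < m) (hx : x ∈ M.currents l d) :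
    M.I m x = 0 := by
  induction hx with
  | zero => exact map_zero _
  | add _ _ h₁ h₂ => rw [map_add, h₁, h₂, add_zero]
  | smul c _ h₁ => rw [map_smul, h₁, smul_zero]
  | ground hx => exact M.I_pos m hm _ hx
  | E n hn _ h₁ => rw [I_E, h₁, map_zero]
  | F n hn _ h₁ => rw [I_F, h₁, map_zero]
  | I n hn _ h₁ => rw [I_I, h₁, map_zero]
  | weaken _ h₁ => exact h₁
  | raise _ h₁ => exact h₁

/-- A nonzero mode of type `I` adds to the number of such modes or gives zero. -/
theorem I_mem_succ {l : ℕ} {d : ℤ} {x : V} {m : ℤ} (hm : m ≠ 0) (hx : x ∈ M.currents l d) :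
    M.I m x ∈ M.currents (l + 1) (d - m) := by
  rcases lt_or_gt_of_ne hm with h | h
  · exact M.I_neg_mem h hx
  · rw [M.I_pos_eq_zero h hx]; exact zero_mem _

theorem I_mem {l : ℕ} {d : ℤ} {x : V} (m : ℤ) (hx : x ∈ M.currents l d) :
    M.I m x ∈ M.currents l (d - m) := by
  rcases eq_or_ne m 0 with rfl | h
  · rw [I_zero, sub_zero]; exact Submodule.smul_mem _ _ hx
  · exact M.currents_anti (Nat.le_succ l) _ (M.I_mem_succ h hx)

theorem delta_smul_mem {l : ℕ} {d k : ℤ} {x : V} (c : ℂ) (hx : x ∈ M.currents l d) :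
    (if k = 0 then c else 0) • x ∈ M.currents l (d - k) := by
  split_ifs with h
  · rw [h, sub_zero]; exact Submodule.smul_mem _ _ hx
  · rw [zero_smul]; exact zero_mem _

theorem E_mem {l : ℕ} {d : ℤ} {x : V} (m : ℤ) (hx : x ∈ M.currents l d) :
    M.E m x ∈ M.currents l (d - m) := by
  rcases lt_or_ge m 0 with hm | hm
  · exact M.E_neg_mem hm hx
  induction hx with
  | zero => rw [map_zero]; exact zero_mem _
  | add _ _ h₁ h₂ => rw [map_add]; exact add_mem h₁ h₂
  | smul c _ h₁ => rw [map_smul]; exact Submodule.smul_mem _ c h₁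
  | ground hx =>
    rcases hm.eq_or_lt with rfl | h
    · exact IsCurrent.ground (M.E_zero _ hx)
    · rw [M.E_pos m h _ hx]; exact zero_mem _
  | E n hn _ h₁ =>
    rw [E_E]; convert M.E_neg_mem (by omega : -n < 0) h₁ using 1; congr 1; ring
  | @F l d x n hn hx h₁ =>
    rw [E_F, show d + n - m = d - (m + -n) by ring]
    refine add_mem (add_mem ?_ (M.I_mem _ hx)) (M.delta_smul_mem _ hx)
    convert M.F_neg_mem (by omega : -n < 0) h₁ using 1; congr 1; ring
  | I n hn _ h₁ =>
    rw [← I_E]; convert M.I_neg_mem (by omega : -n < 0) h₁ using 1; congr 1; ring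
  | weaken _ h₁ => exact IsCurrent.weaken h₁
  | raise _ h₁ => exact M.currents_mono _ (by omega) h₁

theorem F_mem {l : ℕ} {d : ℤ} {x : V} (m : ℤ) (hx : x ∈ M.currents l d) :
    M.F m x ∈ M.currents l (d - m) := by
  rcases lt_or_ge m 0 with hm | hm
  · exact M.F_neg_mem hm hx
  induction hx with
  | zero => rw [map_zero]; exact zero_mem _
  | add _ _ h₁ h₂ => rw [map_add]; exact add_mem h₁ h₂
  | smul c _ h₁ => rw [map_smul]; exact Submodule.smul_mem _ c h₁
  | ground hx =>
    rcases hm.eq_or_lt with rfl | h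
    · exact IsCurrent.ground (M.F_zero _ hx)
    · rw [M.F_pos m h _ hx]; exact zero_mem _
  | @E l d x n hn hx h₁ =>
    have := M.E_F (-n) m x
    rw [show M.F m (M.E (-n) x) = M.E (-n) (M.F m x) - M.I (-n + m) x
      - (if -n + m = 0 then ((-n : ℤ) : ℂ) else 0) • x by rw [this]; abel,
      show d + n - m = d - (-n + m) by ring]
    refine sub_mem (sub_mem ?_ (M.I_mem _ hx)) (M.delta_smul_mem _ hx)
    convert M.E_neg_mem (by omega : -n < 0) h₁ using 1; congr 1; ring
  | F n hn _ h₁ =>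
    rw [F_F]; convert M.F_neg_mem (by omega : -n < 0) h₁ using 1; congr 1; ring
  | I n hn _ h₁ =>
    rw [← I_F]; convert M.I_neg_mem (by omega : -n < 0) h₁ using 1; congr 1; ring
  | weaken _ h₁ => exact IsCurrent.weaken h₁
  | raise _ h₁ => exact M.currents_mono _ (by omega) h₁

/-- A mode `J_m` with `m ≥ 0` can remove a mode of type `I`, but not more than one. -/
theorem J_mem {l : ℕ} {d : ℤ} {x : V} {m : ℤ} (hm : 0 ≤ m) (hx : x ∈ M.currents l d) :
    M.J m x ∈ M.currents (l - 1) (d - m) := by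
  induction hx with
  | zero => rw [map_zero]; exact zero_mem _
  | add _ _ h₁ h₂ => rw [map_add]; exact add_mem h₁ h₂
  | smul c _ h₁ => rw [map_smul]; exact Submodule.smul_mem _ c h₁
  | ground hx =>
    rcases hm.eq_or_lt with rfl | h
    · exact IsCurrent.ground (M.J_zero _ hx)
    · rw [M.J_pos m h _ hx]; exact zero_mem _
  | @E l d x n hn hx h₁ =>
    rw [J_E, show d + n - m = d - (m + -n) by ring]
    refine add_mem ?_ (M.currents_anti (Nat.sub_le l 1) _ (M.E_mem _ hx))
    convert M.E_neg_mem (by omega : -n < 0) h₁ using 1; congr 1; ring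
  | @F l d x n hn hx h₁ =>
    rw [J_F, show d + n - m = d - (m + -n) by ring]
    refine sub_mem ?_ (M.currents_anti (Nat.sub_le l 1) _ (M.F_mem _ hx))
    convert M.F_neg_mem (by omega : -n < 0) h₁ using 1; congr 1; ring
  | @I l d x n hn hx h₁ =>
    rw [J_I, show d + n - m = d - (m + -n) by ring]
    refine add_mem (M.currents_anti (by omega : l + 1 - 1 ≤ l - 1 + 1) _ ?_)
      (M.delta_smul_mem _ hx)
    convert M.I_neg_mem (by omega : -n < 0) h₁ using 1; congr 1; ring
  | weaken _ h₁ => exact M.currents_anti (by omega) _ h₁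
  | raise _ h₁ => exact M.currents_mono _ (by omega) h₁

/-! ### Number operators for the modes of types `E`, `F` and `I` -/

/-- The operator `∑ n⁻¹ I_{-n} J_n`, truncated at `n = N`; up to vectors with more modes of type
`I`, it counts these modes. -/
def countI (N : ℤ) : V →ₗ[ℂ] V :=
  ∑ n ∈ Finset.Icc 1 N, (n : ℂ)⁻¹ • M.I (-n) ∘ₗ M.J n

theorem countI_apply (N : ℤ) (x : V) :
    M.countI N x = ∑ n ∈ Finset.Icc 1 N, (n : ℂ)⁻¹ • M.I (-n) (M.J n x) := by
  simp [countI]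

/-- `J_n` removes a mode `I_{-n}`, and its commutators with `E_{-m}` and `F_{-m}` contribute only
terms with one more mode of type `I`. -/
theorem countI_sub_mem {l : ℕ} {d : ℤ} {x : V} {N : ℤ} (hN : d ≤ N) (hx : x ∈ M.currents l d) :
    M.countI N x - (l : ℂ) • x ∈ M.currents (l + 1) d := by
  induction hx with
  | zero => simp
  | add _ _ h₁ h₂ =>
    rw [map_add, smul_add, add_sub_add_comm]; exact add_mem (h₁ hN) (h₂ hN)
  | smul c _ h₁ =>
    rw [map_smul, smul_comm, ← smul_sub]; exact Submodule.smul_mem _ c (h₁ hN)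
  | ground hx =>
    rw [countI_apply, Finset.sum_eq_zero]
    · simp
    · intro n hn
      rw [M.J_pos n (by simp at hn; omega) _ hx, map_zero, smul_zero]
  | @E l d x m hm hx h₁ =>
    have h : M.countI N (M.E (-m) x) = M.E (-m) (M.countI N x)
        + ∑ n ∈ Finset.Icc 1 N, (n : ℂ)⁻¹ • M.I (-n) (M.E (n + -m) x) := by
      simp only [countI_apply, map_sum, ← Finset.sum_add_distrib]
      refine Finset.sum_congr rfl fun n _ => ?_
      rw [J_E, map_add, smul_add, I_E, map_smul]
    rw [h, add_sub_right_comm, ← map_smul, ← map_sub]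
    refine add_mem (IsCurrent.E m hm (h₁ (by omega))) (sum_mem fun n hn => ?_)
    refine Submodule.smul_mem _ _ ?_
    convert M.I_mem_succ (m := -n) (by simp at hn; omega) (M.E_mem (n + -m) hx) using 2; ring
  | @F l d x m hm hx h₁ =>
    have h : M.countI N (M.F (-m) x) = M.F (-m) (M.countI N x)
        - ∑ n ∈ Finset.Icc 1 N, (n : ℂ)⁻¹ • M.I (-n) (M.F (n + -m) x) := by
      simp only [countI_apply, map_sum, ← Finset.sum_sub_distrib]
      refine Finset.sum_congr rfl fun n _ => ?_
      rw [J_F, map_sub, smul_sub, I_F, map_smul]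
    rw [h, sub_right_comm, ← map_smul, ← map_sub]
    refine sub_mem (IsCurrent.F m hm (h₁ (by omega))) (sum_mem fun n hn => ?_)
    refine Submodule.smul_mem _ _ ?_
    convert M.I_mem_succ (m := -n) (by simp at hn; omega) (M.F_mem (n + -m) hx) using 2; ring
  | @I l d x m hm hx h₁ =>
    rcases lt_or_ge d 0 with hd | hd
    · rw [M.eq_zero_of_mem_currents hx (by omega)]; simp
    have h : M.countI N (M.I (-m) x) = M.I (-m) (M.countI N x) + M.I (-m) x := by
      simp only [countI_apply, map_sum]
      have hterm : ∀ n ∈ Finset.Icc 1 N, (n : ℂ)⁻¹ • M.I (-n) (M.J n (M.I (-m) x)) =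
          M.I (-m) ((n : ℂ)⁻¹ • M.I (-n) (M.J n x)) + if m = n then M.I (-m) x else 0 := by
        intro n hn
        have hn0 : (n : ℂ) ≠ 0 := by simp at hn; exact_mod_cast (by omega : n ≠ 0)
        rw [J_I, map_add, smul_add, I_I]
        congr 1
        · rw [map_smul]
        · by_cases hmn : m = n
          · subst hmn; simp [hn0]
          · rw [if_neg (by omega), if_neg hmn]; simp
      rw [Finset.sum_congr rfl hterm, Finset.sum_add_distrib, Finset.sum_ite_eq,
        if_pos (by simp; omega)]
    rw [h, Nat.cast_succ, add_smul, one_smul, add_sub_add_right_eq_sub, ← map_smul, ← map_sub]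
    exact IsCurrent.I m hm (h₁ (by omega))
  | @weaken l d x hx h₁ =>
    have h := add_mem (M.currents_anti (Nat.le_succ _) _ (h₁ hN)) hx
    convert h using 1
    push_cast; module
  | raise _ h₁ => exact M.currents_mono _ (by omega) (h₁ (by omega))

/-- A vector with at least one mode of type `I` that is annihilated by all `J_n`, `n > 0`, vanishes:
`countI` shows that it has arbitrarily many modes of type `I`, but its degree is bounded. -/
theorem eq_zero_of_mem_currents_one {d : ℤ} {x : V} (hx : x ∈ M.currents 1 d)
    (hJ : ∀ n, 0 < n → M.J n x = 0) : x = 0 := by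
  have key : ∀ l : ℕ, x ∈ M.currents (l + 1) d := by
    intro l
    induction l with
    | zero => exact hx
    | succ l ih =>
      have h := M.countI_sub_mem le_rfl ih
      rw [countI_apply, Finset.sum_eq_zero, zero_sub, neg_mem_iff] at h
      · exact (Submodule.smul_mem_iff _ (by exact_mod_cast Nat.succ_ne_zero l)).1 h
      · intro n hn
        rw [hJ n (by simp at hn; omega), map_zero, smul_zero]
  exact M.eq_zero_of_mem_currents (key d.toNat) (by push_cast; omega)

/-- The operator `∑ (n / (n + i) F_{-n} E_n + n / (n - i) E_{-n} F_n)`, truncated at `n = N`. It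
measures the degree in the modes `E_{-n}` and `F_{-n}`, up to terms of lower degree and terms
involving modes of type `I`. -/
def degreeEF (N : ℤ) : V →ₗ[ℂ] V :=
  ∑ n ∈ Finset.Icc 1 N, ((n / (n + i) : ℂ) • M.F (-n) ∘ₗ M.E n
    + (n / (n - i) : ℂ) • M.E (-n) ∘ₗ M.F n)

theorem degreeEF_apply (N : ℤ) (x : V) :
    M.degreeEF N x = ∑ n ∈ Finset.Icc 1 N, ((n / (n + i) : ℂ) • M.F (-n) (M.E n x)
      + (n / (n - i) : ℂ) • M.E (-n) (M.F n x)) := by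
  simp [degreeEF]

theorem degreeEF_mem {l : ℕ} {d : ℤ} {x : V} (N : ℤ) (hx : x ∈ M.currents l d) :
    M.degreeEF N x ∈ M.currents l d := by
  rw [degreeEF_apply]
  refine sum_mem fun n _ => add_mem (Submodule.smul_mem _ _ ?_) (Submodule.smul_mem _ _ ?_)
  · convert M.F_mem (-n) (M.E_mem n hx) using 2; ring
  · convert M.E_mem (-n) (M.F_mem n hx) using 2; ring

/-- The diagonal term `n = m` of `degreeEF` contributes the degree `m` of `E_{-m}` or `F_{-m}`, since
`F_m E_{-m} = E_{-m} F_m + (m - i)` and `E_m F_{-m} = F_{-m} E_m + (m + i)`; all other commutators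
produce modes `I_k` with `k ≠ 0`. -/
theorem degreeEF_sub_mem (hi : ∀ n : ℤ, i ≠ n) {l : ℕ} {d : ℤ} {x : V} {N : ℤ} (hN : d ≤ N)
    (hx : x ∈ M.currents l d) :
    M.degreeEF N x - (d : ℂ) • x ∈ M.currents 0 (d - 1) ⊔ M.currents 1 d := by
  have le_sup (d e : ℤ) (h : d ≤ e) : M.currents 0 (d - 1) ⊔ M.currents 1 d ≤
      M.currents 0 (e - 1) ⊔ M.currents 1 e :=
    sup_le_sup (M.currents_mono _ (by omega)) (M.currents_mono _ h)
  induction hx with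
  | zero => simp
  | add _ _ h₁ h₂ =>
    rw [map_add, smul_add, add_sub_add_comm]; exact add_mem (h₁ hN) (h₂ hN)
  | smul c _ h₁ =>
    rw [map_smul, smul_comm, ← smul_sub]; exact Submodule.smul_mem _ c (h₁ hN)
  | ground hx =>
    rw [degreeEF_apply, Finset.sum_eq_zero]
    · simp
    · intro n hn
      have hn : 0 < n := by simp at hn; omega
      rw [M.E_pos n hn _ hx, M.F_pos n hn _ hx]; simp
  | @E l d x m hm hx h₁ =>
    rcases lt_or_ge d 0 with hd | hd
    · rw [M.eq_zero_of_mem_currents hx (by omega)]; simp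
    have hx0 := M.currents_anti (Nat.zero_le l) _ hx
    -- The `n`-th summand commutes with `E_{-m}` up to the diagonal term and modes of type `I`.
    have hterm : ∀ n ∈ Finset.Icc 1 N, ∃ z ∈ M.currents 1 (d + m),
        (n / (n + i) : ℂ) • M.F (-n) (M.E n (M.E (-m) x))
          + (n / (n - i) : ℂ) • M.E (-n) (M.F n (M.E (-m) x)) =
        M.E (-m) ((n / (n + i) : ℂ) • M.F (-n) (M.E n x)
          + (n / (n - i) : ℂ) • M.E (-n) (M.F n x)) + (if m = n then (m : ℂ) • M.E (-m) x else 0)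
          + z := by
      intro n hn
      have hn : 0 < n := by simp at hn; omega
      have e1 : M.F (-n) (M.E (-m) (M.E n x)) =
          M.E (-m) (M.F (-n) (M.E n x)) - M.I (-m + -n) (M.E n x) := by
        rw [E_F, if_neg (by omega)]; module
      have m1 : M.I (-m + -n) (M.E n x) ∈ M.currents 1 (d + m) := by
        convert M.I_mem_succ (m := -m + -n) (by omega) (M.E_mem n hx0) using 2; ring
      have e2 := M.E_F (-m) n x
      by_cases hmn : m = n
      · subst hmn
        have hne : (m - i : ℂ) ≠ 0 := sub_ne_zero.2 (hi m).symm
        refine ⟨-((m / (m + i) : ℂ) • M.I (-m + -m) (M.E m x)),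
          neg_mem (Submodule.smul_mem _ _ m1), ?_⟩
        have e3 : M.F m (M.E (-m) x) = M.E (-m) (M.F m x) + (m - i : ℂ) • x := by
          rw [e2, neg_add_cancel, if_pos rfl, I_zero]; push_cast; module
        rw [M.E_E m, e1, e3, if_pos rfl]
        simp only [map_add, map_smul, smul_add, smul_sub, smul_smul, div_mul_cancel₀ _ hne]
        abel
      · refine ⟨-((n / (n + i) : ℂ) • M.I (-m + -n) (M.E n x))
            - (n / (n - i) : ℂ) • M.E (-n) (M.I (-m + n) x),
          sub_mem (neg_mem (Submodule.smul_mem _ _ m1)) (Submodule.smul_mem _ _ ?_), ?_⟩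
        · convert M.E_mem (-n) (M.I_mem_succ (m := -m + n) (by omega) hx0) using 2; ring
        have e3 : M.F n (M.E (-m) x) = M.E (-m) (M.F n x) - M.I (-m + n) x := by
          rw [e2, if_neg (by omega)]; module
        rw [M.E_E n, e1, e3, if_neg hmn]
        simp only [map_add, map_sub, map_smul, smul_sub, M.E_E (-n) (-m)]
        abel
    choose! z hz hterm using hterm
    rw [degreeEF_apply, Finset.sum_congr rfl hterm, Finset.sum_add_distrib, Finset.sum_add_distrib,
      Finset.sum_ite_eq, if_pos (by simp; omega), ← map_sum, ← degreeEF_apply]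
    obtain ⟨u, hu, w, hw, huw⟩ := Submodule.mem_sup.1 (h₁ (by omega))
    have : M.E (-m) (M.degreeEF N x) + (m : ℂ) • M.E (-m) x + ∑ n ∈ Finset.Icc 1 N, z n
        - ((d + m : ℤ) : ℂ) • M.E (-m) x =
        M.E (-m) u + (M.E (-m) w + ∑ n ∈ Finset.Icc 1 N, z n) := by
      rw [← add_assoc, ← map_add, huw, map_sub, map_smul]; push_cast; module
    rw [this]
    refine Submodule.add_mem_sup ?_ (add_mem (IsCurrent.E m hm hw) (sum_mem hz))
    rw [show d + m - 1 = d - 1 + m by ring]; exact IsCurrent.E m hm hu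
  | @F l d x m hm hx h₁ =>
    rcases lt_or_ge d 0 with hd | hd
    · rw [M.eq_zero_of_mem_currents hx (by omega)]; simp
    have hx0 := M.currents_anti (Nat.zero_le l) _ hx
    have hterm : ∀ n ∈ Finset.Icc 1 N, ∃ z ∈ M.currents 1 (d + m),
        (n / (n + i) : ℂ) • M.F (-n) (M.E n (M.F (-m) x))
          + (n / (n - i) : ℂ) • M.E (-n) (M.F n (M.F (-m) x)) =
        M.F (-m) ((n / (n + i) : ℂ) • M.F (-n) (M.E n x)
          + (n / (n - i) : ℂ) • M.E (-n) (M.F n x)) + (if m = n then (m : ℂ) • M.F (-m) x else 0)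
          + z := by
      intro n hn
      have hn : 0 < n := by simp at hn; omega
      have e1 : M.E (-n) (M.F (-m) (M.F n x)) =
          M.F (-m) (M.E (-n) (M.F n x)) + M.I (-n + -m) (M.F n x) := by
        rw [E_F, if_neg (by omega)]; module
      have m1 : M.I (-n + -m) (M.F n x) ∈ M.currents 1 (d + m) := by
        convert M.I_mem_succ (m := -n + -m) (by omega) (M.F_mem n hx0) using 2; ring
      have e2 := M.E_F n (-m) x
      by_cases hmn : m = n
      · subst hmn
        have hne : (m + i : ℂ) ≠ 0 := by
          intro h
          exact hi (-m) (by push_cast; linear_combination h)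
        refine ⟨(m / (m - i) : ℂ) • M.I (-m + -m) (M.F m x), Submodule.smul_mem _ _ m1, ?_⟩
        have e3 : M.E m (M.F (-m) x) = M.F (-m) (M.E m x) + (m + i : ℂ) • x := by
          rw [e2, add_neg_cancel, if_pos rfl, I_zero]; module
        rw [M.F_F m, e1, e3, if_pos rfl]
        simp only [map_add, map_smul, smul_add, smul_smul, div_mul_cancel₀ _ hne]
        abel
      · refine ⟨(n / (n - i) : ℂ) • M.I (-n + -m) (M.F n x)
            + (n / (n + i) : ℂ) • M.F (-n) (M.I (n + -m) x),
          add_mem (Submodule.smul_mem _ _ m1) (Submodule.smul_mem _ _ ?_), ?_⟩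
        · convert M.F_mem (-n) (M.I_mem_succ (m := n + -m) (by omega) hx0) using 2; ring
        have e3 : M.E n (M.F (-m) x) = M.F (-m) (M.E n x) + M.I (n + -m) x := by
          rw [e2, if_neg (by omega)]; module
        rw [M.F_F n, e1, e3, if_neg hmn]
        simp only [map_add, map_smul, smul_add, M.F_F (-n) (-m)]
        abel
    choose! z hz hterm using hterm
    rw [degreeEF_apply, Finset.sum_congr rfl hterm, Finset.sum_add_distrib, Finset.sum_add_distrib,
      Finset.sum_ite_eq, if_pos (by simp; omega), ← map_sum, ← degreeEF_apply]
    obtain ⟨u, hu, w, hw, huw⟩ := Submodule.mem_sup.1 (h₁ (by omega))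
    have : M.F (-m) (M.degreeEF N x) + (m : ℂ) • M.F (-m) x + ∑ n ∈ Finset.Icc 1 N, z n
        - ((d + m : ℤ) : ℂ) • M.F (-m) x =
        M.F (-m) u + (M.F (-m) w + ∑ n ∈ Finset.Icc 1 N, z n) := by
      rw [← add_assoc, ← map_add, huw, map_sub, map_smul]; push_cast; module
    rw [this]
    refine Submodule.add_mem_sup ?_ (add_mem (IsCurrent.F m hm hw) (sum_mem hz))
    rw [show d + m - 1 = d - 1 + m by ring]; exact IsCurrent.F m hm hu
  | @I l d x m hm hx h₁ =>
    have h := M.currents_anti (by omega : 1 ≤ l + 1) _ (IsCurrent.I m hm hx)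
    exact Submodule.mem_sup_right
      (sub_mem (M.degreeEF_mem N h) (Submodule.smul_mem _ _ h))
  | weaken _ h₁ => exact h₁ hN
  | @raise l d x hx h₁ =>
    have h := sub_mem (le_sup d (d + 1) (by omega) (h₁ (by omega)))
      (Submodule.mem_sup_left (T := M.currents 1 (d + 1)) (S := M.currents 0 (d + 1 - 1)) (x := x)
        (by rw [add_sub_cancel_right]; exact M.currents_anti (Nat.zero_le l) _ hx))
    convert h using 1
    push_cast; module

/-- A vector without modes of type `J` that is annihilated by all `E_n` and `F_n`, `n > 0`, lies in `G`
up to vectors with modes of type `I`. -/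
theorem mem_G_sup_of_mem_currents (hi : ∀ n : ℤ, i ≠ n) {d : ℤ} {x : V}
    (hx : x ∈ M.currents 0 d)
    (hE : ∀ n, 0 < n → M.E n x = 0) (hF : ∀ n, 0 < n → M.F n x = 0) :
    x ∈ M.G ⊔ M.currents 1 d := by
  rcases lt_or_ge d 0 with hd | hd
  · rw [M.eq_zero_of_mem_currents hx (by simpa using hd)]; exact zero_mem _
  have hxN : M.degreeEF d x = 0 := by
    rw [degreeEF_apply]
    refine Finset.sum_eq_zero fun n hn => ?_
    have hn : 0 < n := by simp at hn; omega
    rw [hE n hn, hF n hn]; simp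
  -- Descending induction on the degree `d - k` of the part of `x` without modes of type `I`.
  have key : ∀ k : ℕ, (k : ℤ) ≤ d → x ∈ M.currents 0 (d - k) ⊔ M.currents 1 d := by
    intro k
    induction k with
    | zero => intro _; exact Submodule.mem_sup_left (by simpa using hx)
    | succ k ih =>
      intro hk
      obtain ⟨y, hy, z, hz, rfl⟩ := Submodule.mem_sup.1 (ih (by omega))
      refine add_mem ?_ (Submodule.mem_sup_right hz)
      have h1 := M.degreeEF_sub_mem hi (by omega : d - k ≤ d) hy
      have h2 : M.degreeEF d y = -M.degreeEF d z := by
        rw [map_add] at hxN; exact eq_neg_of_add_eq_zero_left hxN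
      have h3 : ((d - k : ℤ) : ℂ) • y ∈ M.currents 0 (d - k - 1) ⊔ M.currents 1 d := by
        have h4 := sub_mem (neg_mem (Submodule.mem_sup_right (S := M.currents 0 (d - k - 1))
          (M.degreeEF_mem d hz)))
          (sup_le_sup_left (M.currents_mono 1 (by omega : d - k ≤ d)) _ h1)
        rw [h2] at h4
        convert h4 using 1; abel
      have h5 := (Submodule.smul_mem_iff _
        (Int.cast_ne_zero.2 (by push_cast at hk; omega : d - k ≠ 0))).1 h3
      convert h5 using 3; push_cast; ring
  obtain ⟨y, hy, z, hz, rfl⟩ := Submodule.mem_sup.1 (key d.toNat (by omega))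
  exact Submodule.add_mem_sup (M.mem_G_of_mem_currents hy (by omega)) hz

/-! ### Descendants under the modes of type `J` -/

/-- `IsDescendant k d x`: the vector `x` is a combination of vectors of total degree at most `d`,
obtained from vectors of `M.currents 0` by applying fewer than `k` modes `J_{-n}` with `n > 0`. -/
inductive IsDescendant : ℕ → ℤ → V → Prop
  | zero (k d) : IsDescendant k d 0
  | add {k d x y} : IsDescendant k d x → IsDescendant k d y → IsDescendant k d (x + y)
  | smul {k d x} (c : ℂ) : IsDescendant k d x → IsDescendant k d (c • x)
  | current {d x} : x ∈ M.currents 0 d → IsDescendant 1 d x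
  | J {k d x} (n : ℤ) : 0 < n → IsDescendant k d x → IsDescendant (k + 1) (d + n) (M.J (-n) x)
  | weaken {k d x} : IsDescendant k d x → IsDescendant (k + 1) d x
  | raise {k d x} : IsDescendant k d x → IsDescendant k (d + 1) x

/-- The subspace of the vectors satisfying `IsDescendant k d`. -/
def descendants (k : ℕ) (d : ℤ) : Submodule ℂ V where
  carrier := {x | M.IsDescendant k d x}
  zero_mem' := .zero k d
  add_mem' := .add
  smul_mem' c _ := .smul c

theorem descendants_mono {k k' : ℕ} {d d' : ℤ} (hk : k ≤ k') (hd : d ≤ d') :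
    M.descendants k d ≤ M.descendants k' d' := by
  have h₁ : M.descendants k d ≤ M.descendants k' d := by
    induction hk with
    | refl => exact le_rfl
    | step _ ih => exact fun x hx => IsDescendant.weaken (ih hx)
  refine h₁.trans ?_
  obtain ⟨n, rfl⟩ := Int.le.dest hd
  clear hd h₁
  induction n with
  | zero => simp
  | succ n ih =>
    intro x hx
    have := IsDescendant.raise (ih hx)
    rwa [add_assoc] at this

/-- `k = 0` asks for fewer than zero modes of type `J`, and degrees are nonnegative. -/
theorem eq_zero_of_mem_descendants {k : ℕ} {d : ℤ} {x : V} (hx : x ∈ M.descendants k d)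
    (h : k = 0 ∨ d < 0) : x = 0 := by
  induction hx with
  | zero => rfl
  | add _ _ h₁ h₂ => rw [h₁ h, h₂ h, add_zero]
  | smul c _ h₁ => rw [h₁ h, smul_zero]
  | current hx => exact M.eq_zero_of_mem_currents hx (by simpa using h)
  | J n hn _ h₁ => rw [h₁ (by omega), map_zero]
  | weaken _ h₁ => exact h₁ (by omega)
  | raise _ h₁ => exact h₁ (by omega)

theorem mem_currents_of_mem_descendants {k : ℕ} {d : ℤ} {x : V} (hx : x ∈ M.descendants k d)
    (h : k ≤ 1) : x ∈ M.currents 0 d := by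
  induction hx with
  | zero => exact zero_mem _
  | add _ _ h₁ h₂ => exact add_mem (h₁ h) (h₂ h)
  | smul c _ h₁ => exact Submodule.smul_mem _ c (h₁ h)
  | current hx => exact hx
  | J n hn hx _ =>
    rw [M.eq_zero_of_mem_descendants hx (by omega), map_zero]; exact zero_mem _
  | weaken _ h₁ => exact h₁ (by omega)
  | raise _ h₁ => exact M.currents_mono _ (by omega) (h₁ h)

theorem J_neg_mem_descendants {k : ℕ} {d : ℤ} {x : V} {m : ℤ} (hm : m < 0)
    (hx : x ∈ M.descendants k d) : M.J m x ∈ M.descendants (k + 1) (d - m) := by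
  have h := IsDescendant.J (-m) (by omega) hx
  rwa [neg_neg, ← sub_eq_add_neg] at h

theorem E_mem_descendants {k : ℕ} {d : ℤ} {x : V} (m : ℤ) (hx : x ∈ M.descendants k d) :
    M.E m x ∈ M.descendants k (d - m) := by
  induction hx generalizing m with
  | zero => rw [map_zero]; exact zero_mem _
  | add _ _ h₁ h₂ => rw [map_add]; exact add_mem (h₁ m) (h₂ m)
  | smul c _ h₁ => rw [map_smul]; exact Submodule.smul_mem _ c (h₁ m)
  | current hx => exact IsDescendant.current (M.E_mem m hx)
  | @J k d x n hn hx h₁ =>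
    rw [show M.E m (M.J (-n) x) = M.J (-n) (M.E m x) - M.E (-n + m) x by rw [J_E]; abel]
    refine sub_mem ?_ (M.descendants_mono (Nat.le_succ k) (by omega) (h₁ (-n + m)))
    convert M.J_neg_mem_descendants (by omega : -n < 0) (h₁ m) using 2; ring
  | weaken _ h₁ => exact IsDescendant.weaken (h₁ m)
  | raise _ h₁ => exact M.descendants_mono le_rfl (by omega) (h₁ m)

theorem F_mem_descendants {k : ℕ} {d : ℤ} {x : V} (m : ℤ) (hx : x ∈ M.descendants k d) :
    M.F m x ∈ M.descendants k (d - m) := by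
  induction hx generalizing m with
  | zero => rw [map_zero]; exact zero_mem _
  | add _ _ h₁ h₂ => rw [map_add]; exact add_mem (h₁ m) (h₂ m)
  | smul c _ h₁ => rw [map_smul]; exact Submodule.smul_mem _ c (h₁ m)
  | current hx => exact IsDescendant.current (M.F_mem m hx)
  | @J k d x n hn hx h₁ =>
    rw [show M.F m (M.J (-n) x) = M.J (-n) (M.F m x) + M.F (-n + m) x by rw [J_F]; abel]
    refine add_mem ?_ (M.descendants_mono (Nat.le_succ k) (by omega) (h₁ (-n + m)))
    convert M.J_neg_mem_descendants (by omega : -n < 0) (h₁ m) using 2; ring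
  | weaken _ h₁ => exact IsDescendant.weaken (h₁ m)
  | raise _ h₁ => exact M.descendants_mono le_rfl (by omega) (h₁ m)

theorem I_J (m n : ℤ) (x : V) :
    M.I m (M.J n x) = M.J n (M.I m x) + (if m + n = 0 then (m : ℂ) else 0) • x := by
  rw [J_I, add_assoc, ← add_smul]
  by_cases h : m + n = 0
  · obtain rfl : n = -m := by omega
    simp
  · rw [if_neg (by omega), if_neg h]; simp

theorem I_mem_descendants {k : ℕ} {d : ℤ} {x : V} (m : ℤ) (hx : x ∈ M.descendants k d) :
    M.I m x ∈ M.descendants k (d - m) := by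
  induction hx with
  | zero => rw [map_zero]; exact zero_mem _
  | add _ _ h₁ h₂ => rw [map_add]; exact add_mem h₁ h₂
  | smul c _ h₁ => rw [map_smul]; exact Submodule.smul_mem _ c h₁
  | current hx => exact IsDescendant.current (M.I_mem m hx)
  | @J k d x n hn hx h₁ =>
    rw [I_J]
    refine add_mem ?_ ?_
    · convert M.J_neg_mem_descendants (by omega : -n < 0) h₁ using 2; ring
    · split_ifs with h
      · exact Submodule.smul_mem _ _ (M.descendants_mono (Nat.le_succ k) (by omega) hx)
      · rw [zero_smul]; exact zero_mem _
  | weaken _ h₁ => exact IsDescendant.weaken h₁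
  | raise _ h₁ => exact M.descendants_mono le_rfl (by omega) h₁

theorem J_mem_descendants {k : ℕ} {d : ℤ} {x : V} (m : ℤ) (hx : x ∈ M.descendants k d) :
    M.J m x ∈ M.descendants (k + 1) (d - m) := by
  rcases lt_or_ge m 0 with hm | hm
  · exact M.J_neg_mem_descendants hm hx
  induction hx with
  | zero => rw [map_zero]; exact zero_mem _
  | add _ _ h₁ h₂ => rw [map_add]; exact add_mem h₁ h₂
  | smul c _ h₁ => rw [map_smul]; exact Submodule.smul_mem _ c h₁
  | current hx => exact IsDescendant.weaken (IsDescendant.current (M.J_mem hm hx))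
  | @J k d x n hn hx h₁ =>
    rw [J_J]
    convert M.J_neg_mem_descendants (by omega : -n < 0) h₁ using 2; ring
  | weaken _ h₁ => exact IsDescendant.weaken h₁
  | raise _ h₁ => exact M.descendants_mono le_rfl (by omega) h₁

/-- The operator `∑ n⁻¹ J_{-n} I_n`, truncated at `n = N`, which counts the modes of type `J`. -/
def countJ (N : ℤ) : V →ₗ[ℂ] V :=
  ∑ n ∈ Finset.Icc 1 N, (n : ℂ)⁻¹ • M.J (-n) ∘ₗ M.I n

theorem countJ_apply (N : ℤ) (x : V) :
    M.countJ N x = ∑ n ∈ Finset.Icc 1 N, (n : ℂ)⁻¹ • M.J (-n) (M.I n x) := by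
  simp [countJ]

/-- The number of modes of type `J` is less than `k` on `M.descendants k d`, so that `k - 1` is its
top value. -/
theorem countJ_sub_mem {k : ℕ} {d : ℤ} {x : V} {N : ℤ} (hN : d ≤ N)
    (hx : x ∈ M.descendants k d) :
    M.countJ N x - (k - 1 : ℂ) • x ∈ M.descendants (k - 1) d := by
  induction hx with
  | zero => simp
  | add _ _ h₁ h₂ =>
    rw [map_add, smul_add, add_sub_add_comm]; exact add_mem (h₁ hN) (h₂ hN)
  | smul c _ h₁ =>
    rw [map_smul, smul_comm, ← smul_sub]; exact Submodule.smul_mem _ c (h₁ hN)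
  | current hx =>
    rw [countJ_apply, Finset.sum_eq_zero]
    · simp
    · intro n hn
      rw [M.I_pos_eq_zero (by simp at hn; omega) hx, map_zero, smul_zero]
  | @J k d x m hm hx h₁ =>
    rcases Nat.eq_zero_or_pos k with hk | hk
    · rw [M.eq_zero_of_mem_descendants hx (by omega)]; simp
    rcases lt_or_ge d 0 with hd | hd
    · rw [M.eq_zero_of_mem_descendants hx (by omega)]; simp
    have h : M.countJ N (M.J (-m) x) = M.J (-m) (M.countJ N x) + M.J (-m) x := by
      simp only [countJ_apply, map_sum]
      have hterm : ∀ n ∈ Finset.Icc 1 N, (n : ℂ)⁻¹ • M.J (-n) (M.I n (M.J (-m) x)) =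
          M.J (-m) ((n : ℂ)⁻¹ • M.J (-n) (M.I n x)) + if m = n then M.J (-m) x else 0 := by
        intro n hn
        have hn0 : (n : ℂ) ≠ 0 := by simp at hn; exact_mod_cast (by omega : n ≠ 0)
        rw [I_J, map_add, smul_add, J_J]
        congr 1
        · rw [map_smul]
        · by_cases hmn : m = n
          · subst hmn; simp [hn0]
          · rw [if_neg (by omega), if_neg hmn]; simp
      rw [Finset.sum_congr rfl hterm, Finset.sum_add_distrib, Finset.sum_ite_eq,
        if_pos (by simp; omega)]
    have h' : M.countJ N (M.J (-m) x) - (((k + 1 : ℕ) : ℂ) - 1) • M.J (-m) x =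
        M.J (-m) (M.countJ N x - (k - 1 : ℂ) • x) := by
      rw [h, map_sub, map_smul]; push_cast; module
    rw [h', Nat.add_sub_cancel]
    have := IsDescendant.J m hm (h₁ (by omega))
    rwa [Nat.sub_add_cancel hk] at this
  | @weaken k d x hx h₁ =>
    have h := sub_mem (M.descendants_mono (Nat.sub_le k 1) le_rfl (h₁ hN)) hx
    have h' : M.countJ N x - (((k + 1 : ℕ) : ℂ) - 1) • x = M.countJ N x - (k - 1 : ℂ) • x - x := by
      push_cast; module
    rw [h']; exact h
  | raise _ h₁ => exact M.descendants_mono le_rfl (by omega) (h₁ (by omega))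

/-- A vector annihilated by all `I_n`, `n > 0`, involves no modes of type `J`. -/
theorem mem_currents_of_I_eq_zero {k : ℕ} {d : ℤ} {x : V} (hx : x ∈ M.descendants k d)
    (hI : ∀ n, 0 < n → M.I n x = 0) : x ∈ M.currents 0 d := by
  induction k with
  | zero => exact M.mem_currents_of_mem_descendants hx (by omega)
  | succ k ih =>
    rcases Nat.eq_zero_or_pos k with rfl | hk
    · exact M.mem_currents_of_mem_descendants hx le_rfl
    have h := M.countJ_sub_mem le_rfl hx
    rw [countJ_apply, Finset.sum_eq_zero, zero_sub, neg_mem_iff] at h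
    · refine ih ((Submodule.smul_mem_iff _ ?_).1 h)
      push_cast; rw [add_sub_cancel_right]; exact_mod_cast hk.ne'
    · intro n hn
      rw [hI n (by simp at hn; omega), map_zero, smul_zero]

/-- For `i ∉ ℤ`, the only vectors annihilated by all positive modes are those of `G`. -/
theorem mem_G_of_singular (hi : ∀ n : ℤ, i ≠ n) {k : ℕ} {d : ℤ} {x : V}
    (hx : x ∈ M.descendants k d) (hE : ∀ n, 0 < n → M.E n x = 0) (hF : ∀ n, 0 < n → M.F n x = 0)
    (hI : ∀ n, 0 < n → M.I n x = 0) (hJ : ∀ n, 0 < n → M.J n x = 0) : x ∈ M.G := by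
  obtain ⟨g, hg, z, hz, rfl⟩ := Submodule.mem_sup.1
    (M.mem_G_sup_of_mem_currents hi (M.mem_currents_of_I_eq_zero hx hI) hE hF)
  rw [M.eq_zero_of_mem_currents_one hz, add_zero]
  · exact hg
  · intro n hn
    have := hJ n hn
    rwa [map_add, M.J_pos n hn g hg, zero_add] at this

/-- A nonzero subspace stable under the positive modes meets `G`. -/
theorem exists_mem_G (hi : ∀ n : ℤ, i ≠ n) {S : Submodule ℂ V}
    (hE : ∀ n, 0 < n → ∀ x ∈ S, M.E n x ∈ S) (hF : ∀ n, 0 < n → ∀ x ∈ S, M.F n x ∈ S)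
    (hI : ∀ n, 0 < n → ∀ x ∈ S, M.I n x ∈ S) (hJ : ∀ n, 0 < n → ∀ x ∈ S, M.J n x ∈ S)
    {k : ℕ} {d : ℤ} {x : V} (hx : x ∈ M.descendants k d) (hxS : x ∈ S) (hx0 : x ≠ 0) :
    ∃ g ∈ S, g ∈ M.G ∧ g ≠ 0 := by
  -- Positive modes lower the degree, so induction on the degree reaches a singular vector.
  obtain ⟨c, hc⟩ : ∃ c : ℕ, d < c := ⟨(d + 1).toNat, by omega⟩
  induction c generalizing k d x with
  | zero => exact absurd (M.eq_zero_of_mem_descendants hx (by omega)) hx0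
  | succ c ih =>
    by_contra hcon
    refine hcon ⟨x, hxS, M.mem_G_of_singular hi hx ?_ ?_ ?_ ?_, hx0⟩ <;> intro n hn <;>
      by_contra hne
    · exact hcon (ih (M.E_mem_descendants n hx) (hE n hn x hxS) hne (by omega))
    · exact hcon (ih (M.F_mem_descendants n hx) (hF n hn x hxS) hne (by omega))
    · exact hcon (ih (M.I_mem_descendants n hx) (hI n hn x hxS) hne (by omega))
    · exact hcon (ih (M.J_mem_descendants n hx) (hJ n hn x hxS) hne (by omega))

theorem exists_add_mem_descendants {x y : V} (hx : ∃ k d, x ∈ M.descendants k d)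
    (hy : ∃ k d, y ∈ M.descendants k d) : ∃ k d, x + y ∈ M.descendants k d := by
  obtain ⟨k, d, hx⟩ := hx
  obtain ⟨k', d', hy⟩ := hy
  exact ⟨max k k', max d d',
    add_mem (M.descendants_mono (le_max_left _ _) (le_max_left _ _) hx)
      (M.descendants_mono (le_max_right _ _) (le_max_right _ _) hy)⟩

/-- The subspace of all vectors obtained from `G` by applying modes. -/
def allDescendants : Submodule ℂ V where
  carrier := {x | ∃ k d, x ∈ M.descendants k d}
  zero_mem' := ⟨0, 0, zero_mem _⟩
  add_mem' := M.exists_add_mem_descendants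
  smul_mem' c _ := fun ⟨k, d, hx⟩ => ⟨k, d, Submodule.smul_mem _ c hx⟩

end ModeAction

/-! ### Generators and central elements of the enveloping algebras -/

attribute [local instance 100] LieRing.ofAssociativeRing

theorem H4.eq_sum_basis (A : H4) :
    A = A 0 • H4.E + A 1 • H4.F + A 2 • H4.I + A 3 • H4.J := by
  ext <;> simp <;> simp [H4.E, H4.F, H4.I, H4.J]

theorem UH4.ι_mul_ι (A B : H4) : toUH4 A * toUH4 B = toUH4 B * toUH4 A + toUH4 ⁅A, B⁆ := by
  rw [toUH4, toUH4, toUH4, LieHom.map_lie, LieRing.of_associative_ring_bracket]; abel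

/-- A subalgebra of an enveloping algebra that contains the Lie algebra is everything. -/
theorem subalgebra_eq_top_of_ι_mem {L : Type*} [LieRing L] [LieAlgebra ℂ L]
    (S : Subalgebra ℂ (UniversalEnvelopingAlgebra ℂ L))
    (h : ∀ x, UniversalEnvelopingAlgebra.ι ℂ x ∈ S) : S = ⊤ := by
  let f : L →ₗ⁅ℂ⁆ S :=
    { toFun x := ⟨UniversalEnvelopingAlgebra.ι ℂ x, h x⟩
      map_add' x y := Subtype.ext (by simp)
      map_smul' c x := Subtype.ext (by simp)
      map_lie' := fun {x y} => Subtype.ext (by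
        simp only [LieHom.map_lie, LieRing.of_associative_ring_bracket]; rfl) }
  have hf : S.val.comp (UniversalEnvelopingAlgebra.lift ℂ f) = AlgHom.id ℂ _ := by
    ext x
    simp only [LieHom.coe_comp, Function.comp_apply, AlgHom.coe_toLieHom, AlgHom.comp_apply,
      UniversalEnvelopingAlgebra.lift_ι_apply]
    rfl
  refine eq_top_iff.2 fun u _ => ?_
  have := DFunLike.congr_fun hf u
  rw [AlgHom.comp_apply, AlgHom.id_apply] at this
  rw [← this]
  exact (UniversalEnvelopingAlgebra.lift ℂ f u).2

theorem UH4.commute_of_commute_basis {c : UH4} (hE : Commute c (toUH4 H4.E))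
    (hF : Commute c (toUH4 H4.F)) (hI : Commute c (toUH4 H4.I)) (hJ : Commute c (toUH4 H4.J))
    (u : UH4) : Commute c u := by
  have h := subalgebra_eq_top_of_ι_mem (Subalgebra.centralizer ℂ {c}) fun A => by
    rw [Subalgebra.mem_centralizer_iff]
    rintro _ rfl
    rw [H4.eq_sum_basis A]
    simp only [map_add, map_smul]
    exact (((hE.smul_right _).add_right (hF.smul_right _)).add_right (hI.smul_right _)).add_right
      (hJ.smul_right _)
  exact (Subalgebra.mem_centralizer_iff ℂ).1 (h ▸ Algebra.mem_top : u ∈ Subalgebra.centralizer ℂ {c})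
    c rfl

theorem UH4.commute_I (u : UH4) : Commute (toUH4 H4.I) u := by
  have h (A : H4) : Commute (toUH4 H4.I) (toUH4 A) := by
    rw [Commute, SemiconjBy, UH4.ι_mul_ι, H4.lie_I, toUH4, toUH4, toUH4, map_zero, add_zero]
  exact UH4.commute_of_commute_basis (h _) (h _) (h _) (h _) u

/-- The relations of `𝔥₄` imply that `fe + ab` is central. -/
theorem commute_quadratic {R : Type*} [Ring R] {e f a b : R} (ha : ∀ x, a * x = x * a)
    (hef : e * f = f * e + a) (hbe : b * e = e * b + e) (hbf : b * f = f * b - f) :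
    Commute (f * e + a * b) e ∧ Commute (f * e + a * b) f ∧ Commute (f * e + a * b) a ∧
      Commute (f * e + a * b) b := by
  have h₁ : e * f - f * e - a = 0 := by rw [hef]; abel
  have h₂ : b * e - e * b - e = 0 := by rw [hbe]; abel
  have h₃ : b * f - f * b + f = 0 := by rw [hbf]; abel
  have h₄ (x : R) : a * x - x * a = 0 := sub_eq_zero.2 (ha x)
  refine ⟨sub_eq_zero.1 ?_, sub_eq_zero.1 ?_, (ha _).symm, sub_eq_zero.1 ?_⟩
  · have : (f * e + a * b) * e - e * (f * e + a * b) =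
        -((e * f - f * e - a) * e) + a * (b * e - e * b - e) + (a * e - e * a) * b := by
      noncomm_ring
    rw [this, h₁, h₂, h₄]; simp
  · have : (f * e + a * b) * f - f * (f * e + a * b) =
        f * (e * f - f * e - a) + a * (b * f - f * b + f) + (a * f - f * a) * b
          - (a * f - f * a) := by
      noncomm_ring
    rw [this, h₁, h₃, h₄]; simp
  · have : (f * e + a * b) * b - b * (f * e + a * b) =
        -((b * f - f * b + f) * e) - f * (b * e - e * b - e) + (a * b - b * a) * b := by
      noncomm_ring
    rw [this, h₂, h₃, h₄]; simp

theorem UH4.commute_casimir (u : UH4) : Commute casimir u := by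
  have hEF := UH4.ι_mul_ι H4.E H4.F
  have hJE := UH4.ι_mul_ι H4.J H4.E
  have hJF := UH4.ι_mul_ι H4.J H4.F
  rw [H4.lie_E_F] at hEF
  rw [H4.lie_J_E] at hJE
  rw [H4.lie_J_F, show toUH4 (-H4.F) = -toUH4 H4.F from map_neg _ _, ← sub_eq_add_neg] at hJF
  obtain ⟨hE, hF, hI, hJ⟩ := commute_quadratic (fun x => (UH4.commute_I x).eq) hEF hJE hJF
  exact UH4.commute_of_commute_basis hE hF hI hJ u

/-! ### The dense modules -/

theorem DenseModule.smul_eq_of_central {i j h c : ℂ} {z : UH4} (hz : ∀ u, Commute z u)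
    (hmem : z - algebraMap ℂ UH4 c ∈ denseIdeal i j h) (m : DenseModule i j h) :
    z • m = c • m := by
  obtain ⟨u, rfl⟩ := Submodule.Quotient.mk_surjective _ m
  rw [← Submodule.Quotient.mk_smul, ← Submodule.Quotient.mk_smul, Submodule.Quotient.eq,
    smul_eq_mul, (hz u).eq, Algebra.smul_def, Algebra.commutes, ← mul_sub]
  exact (denseIdeal i j h).smul_mem u hmem

theorem DenseModule.I_smul {i j h : ℂ} (m : DenseModule i j h) : toUH4 H4.I • m = i • m :=
  smul_eq_of_central UH4.commute_I (Submodule.subset_span (by simp)) m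

theorem DenseModule.casimir_smul {i j h : ℂ} (m : DenseModule i j h) : casimir • m = h • m :=
  smul_eq_of_central UH4.commute_casimir (Submodule.subset_span (by simp)) m

/-! ### The modes in the enveloping algebra of the affine algebra -/

theorem mode_add (A B : H4) (n : ℤ) : mode (A + B) n = mode A n + mode B n := by
  rw [mode, TensorProduct.tmul_add, mode, mode, ← LieAlgebra.of_add, Prod.mk_add_mk, add_zero]

theorem mode_smul (c : ℂ) (A : H4) (n : ℤ) : mode (c • A) n = c • mode A n := by
  rw [mode, TensorProduct.tmul_smul, mode, ← LieAlgebra.of_smul, Prod.smul_mk, smul_zero]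

theorem modeU_smul (c : ℂ) (A : H4) (n : ℤ) : modeU (c • A) n = c • modeU A n := by
  rw [modeU, mode_smul, map_smul]; rfl

theorem modeU_mul_modeU (A B : H4) (m n : ℤ) :
    modeU A m * modeU B n = modeU B n * modeU A m + modeU ⁅A, B⁆ (m + n)
      + (if m + n = 0 then (m : ℂ) * H4.form A B else 0) • centralU := by
  have h := congrArg (UniversalEnvelopingAlgebra.ι ℂ) (mode_lie_mode A B m n)
  rw [LieHom.map_lie, LieRing.of_associative_ring_bracket, map_add, map_smul] at h
  rw [add_assoc]
  exact sub_eq_iff_eq_add'.1 h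

theorem commute_centralU_modeU (A : H4) (m : ℤ) : Commute centralU (modeU A m) := by
  have h := congrArg (UniversalEnvelopingAlgebra.ι ℂ) (mode_lie_central A m)
  rw [LieHom.map_lie, LieRing.of_associative_ring_bracket, map_zero] at h
  exact (sub_eq_zero.1 h).symm

/-- The modes of the basis vectors and `K` span the affine algebra. -/
theorem AffineH4.mem_of_modes {S : Submodule ℂ AffineH4}
    (hE : ∀ n, mode H4.E n ∈ S) (hF : ∀ n, mode H4.F n ∈ S) (hI : ∀ n, mode H4.I n ∈ S)
    (hJ : ∀ n, mode H4.J n ∈ S) (hK : central ∈ S) (x : AffineH4) : x ∈ S := by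
  have hmode (A : H4) (n : ℤ) : mode A n ∈ S := by
    rw [H4.eq_sum_basis A]
    simp only [mode_add, mode_smul]
    exact add_mem (add_mem (add_mem (S.smul_mem _ (hE n)) (S.smul_mem _ (hF n)))
      (S.smul_mem _ (hI n))) (S.smul_mem _ (hJ n))
  have hloop (y : LieAlgebra.loopAlgebra ℂ ℤ H4) :
      LieAlgebra.ofProd affineCocycle (y, 0) ∈ S := by
    obtain ⟨y, rfl⟩ := (LieAlgebra.LoopAlgebra.toFinsupp ℂ ℤ H4).symm.surjective y
    induction y using Finsupp.induction_linear with
    | zero => rw [map_zero]; exact S.zero_mem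
    | add y z hy hz =>
      have := S.add_mem hy hz
      rwa [← LieAlgebra.of_add, Prod.mk_add_mk, add_zero, ← map_add] at this
    | single n A =>
      rw [LieAlgebra.LoopAlgebra.toFinsupp_symm_single]
      exact hmode A n
  obtain ⟨⟨y, c⟩, rfl⟩ := (LieAlgebra.ofProd affineCocycle).surjective x
  obtain ⟨c, rfl⟩ := (TrivialLieModule.equiv ℂ (LieAlgebra.loopAlgebra ℂ ℤ H4) ℂ).symm.surjective c
  -- The sign compensates for the one in the definition of `central`.
  have := S.add_mem (hloop y) (S.smul_mem (-c) hK)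
  rw [central, ← LieAlgebra.of_smul, ← LieAlgebra.of_add, Prod.smul_mk, smul_zero,
    Prod.mk_add_mk, add_zero, zero_add, ← map_smul] at this
  simpa using this

/-! ### Induced modules -/

section Induced

variable (M : Type) [AddCommGroup M] [Module ℂ M] [Module UH4 M]

/-- The canonical map `m ↦ 1 ⊗ m` from a module to its induced module. -/
def Induced.incl : M →ₗ[ℂ] Induced M :=
  ((inductionRelations M).mkQ.restrictScalars ℂ) ∘ₗ TensorProduct.mk ℂ UAffine M 1

variable {M}

theorem Induced.mk_tmul (u : UAffine) (m : M) :
    (Submodule.Quotient.mk (u ⊗ₜ[ℂ] m) : Induced M) = u • Induced.incl M m := by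
  change _ = u • Submodule.Quotient.mk (1 ⊗ₜ[ℂ] m)
  rw [← Submodule.Quotient.mk_smul, TensorProduct.smul_tmul', smul_eq_mul, mul_one]

theorem Induced.zeroMode_smul_incl (A : H4) (m : M) :
    modeU A 0 • Induced.incl M m = Induced.incl M (toUH4 A • m) := by
  rw [← mk_tmul]
  exact (Submodule.Quotient.eq _).2 (Submodule.subset_span (.inl (.inl ⟨A, m, rfl⟩)))

theorem Induced.posMode_smul_incl (A : H4) {n : ℤ} (hn : 0 < n) (m : M) :
    modeU A n • Induced.incl M m = 0 := by
  rw [← mk_tmul]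
  exact (Submodule.Quotient.mk_eq_zero _).2 (Submodule.subset_span (.inl (.inr ⟨A, n, m, hn, rfl⟩)))

theorem Induced.centralU_smul_incl (m : M) :
    centralU • Induced.incl M m = Induced.incl M m := by
  rw [← mk_tmul]
  exact (Submodule.Quotient.eq _).2 (Submodule.subset_span (.inr ⟨m, rfl⟩))

/-- An induced module is generated by the module from which it is induced. -/
theorem Induced.mem_of_modes {S : Submodule ℂ (Induced M)} (hincl : ∀ m, Induced.incl M m ∈ S)
    (hE : ∀ n, ∀ x ∈ S, modeU H4.E n • x ∈ S) (hF : ∀ n, ∀ x ∈ S, modeU H4.F n • x ∈ S)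
    (hI : ∀ n, ∀ x ∈ S, modeU H4.I n • x ∈ S) (hJ : ∀ n, ∀ x ∈ S, modeU H4.J n • x ∈ S)
    (hK : ∀ x ∈ S, centralU • x ∈ S) (x : Induced M) : x ∈ S := by
  let stab : Subalgebra ℂ UAffine :=
    { carrier := {u | ∀ x ∈ S, u • x ∈ S}
      mul_mem' := fun {u v} hu hv x hx => by rw [mul_smul]; exact hu _ (hv x hx)
      add_mem' := fun {u v} hu hv x hx => by rw [add_smul]; exact add_mem (hu x hx) (hv x hx)
      algebraMap_mem' := fun c x hx => by rw [algebraMap_smul]; exact S.smul_mem c hx }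
  have hstab : stab = ⊤ := subalgebra_eq_top_of_ι_mem stab fun y =>
    AffineH4.mem_of_modes (S := stab.toSubmodule.comap
      (UniversalEnvelopingAlgebra.ι ℂ : AffineH4 →ₗ⁅ℂ⁆ UAffine).toLinearMap) hE hF hI hJ hK y
  obtain ⟨t, rfl⟩ := Submodule.Quotient.mk_surjective _ x
  induction t using TensorProduct.induction_on with
  | zero => rw [Submodule.Quotient.mk_zero]; exact zero_mem _
  | add s t hs ht => rw [Submodule.Quotient.mk_add]; exact add_mem hs ht
  | tmul u m =>
    rw [mk_tmul]
    exact (hstab ▸ Algebra.mem_top : u ∈ stab) _ (hincl m)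

/-- Induced modules have level one. -/
theorem Induced.centralU_smul (x : Induced M) : centralU • x = x := by
  have hmode (A : H4) (n : ℤ) (x : Induced M) (hx : centralU • x = x) :
      centralU • modeU A n • x = modeU A n • x := by
    rw [← mul_smul, (commute_centralU_modeU A n).eq, mul_smul, hx]
  exact Induced.mem_of_modes
    (S := LinearMap.eqLocus (Algebra.lsmul ℂ ℂ (Induced M) centralU) LinearMap.id)
    centralU_smul_incl (hmode _) (hmode _) (hmode _) (hmode _)
    (fun x hx => congrArg (centralU • ·) hx) x

theorem Induced.modeU_smul_modeU_smul (A B : H4) (m n : ℤ) (x : Induced M) :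
    modeU A m • modeU B n • x = modeU B n • modeU A m • x + modeU ⁅A, B⁆ (m + n) • x
      + (if m + n = 0 then (m : ℂ) * H4.form A B else 0) • x := by
  rw [← mul_smul, modeU_mul_modeU, add_smul, add_smul, mul_smul, smul_assoc, centralU_smul]

end Induced

/-! ### Ground states of the relaxed modules -/

theorem H4.form_E_E : H4.form H4.E H4.E = 0 := by
  rw [H4.form_apply]; simp [H4.E]

theorem H4.form_F_F : H4.form H4.F H4.F = 0 := by
  rw [H4.form_apply]; simp [H4.F]

theorem H4.form_E_F : H4.form H4.E H4.F = 1 := by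
  rw [H4.form_apply]; simp [H4.E, H4.F]

theorem H4.form_I_E : H4.form H4.I H4.E = 0 := by
  rw [H4.form_apply]; simp [H4.I, H4.E]

theorem H4.form_I_F : H4.form H4.I H4.F = 0 := by
  rw [H4.form_apply]; simp [H4.I, H4.F]

theorem H4.form_I_I : H4.form H4.I H4.I = 0 := by
  rw [H4.form_apply]; simp [H4.I]

theorem H4.form_J_E : H4.form H4.J H4.E = 0 := by
  rw [H4.form_apply]; simp [H4.J, H4.E]

theorem H4.form_J_F : H4.form H4.J H4.F = 0 := by
  rw [H4.form_apply]; simp [H4.J, H4.F]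

theorem H4.form_J_I : H4.form H4.J H4.I = 1 := by
  rw [H4.form_apply]; simp [H4.J, H4.I]

theorem H4.form_J_J : H4.form H4.J H4.J = 0 := by
  rw [H4.form_apply]; simp [H4.J]

theorem H4.lie_right_I (A : H4) : ⁅A, H4.I⁆ = 0 := by
  rw [← lie_skew, H4.lie_I, neg_zero]

theorem modeU_zero (n : ℤ) : modeU 0 n = 0 := by
  simpa using modeU_smul 0 0 n

theorem modeU_neg (A : H4) (n : ℤ) : modeU (-A) n = -modeU A n := by
  simpa using modeU_smul (-1) A n

section Relaxed

variable {i j h : ℂ}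

/-- `I_0` is central in the affine algebra, so it acts on all of `R_{i,j;h}` as on the dense module. -/
theorem RelaxedModule.I_zero_smul (x : RelaxedModule i j h) : modeU H4.I 0 • x = i • x := by
  have hcomm (A : H4) (n : ℤ) (x : RelaxedModule i j h) (hx : modeU H4.I 0 • x = i • x) :
      modeU H4.I 0 • modeU A n • x = i • modeU A n • x := by
    rw [Induced.modeU_smul_modeU_smul, hx, H4.lie_I, modeU_zero, smul_comm i]
    simp
  exact Induced.mem_of_modes
    (S := LinearMap.eqLocus (Algebra.lsmul ℂ ℂ _ (modeU H4.I 0)) (i • LinearMap.id))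
    (fun m => by
      change modeU H4.I 0 • Induced.incl _ m = i • Induced.incl _ m
      rw [Induced.zeroMode_smul_incl, DenseModule.I_smul, map_smul])
    (hcomm _) (hcomm _) (hcomm _) (hcomm _)
    (fun x hx => by rw [Induced.centralU_smul]; exact hx) x

/-- The modes acting on `R_{i,j;h}`, with `G` the copy of the dense module in it. -/
def RelaxedModule.modeAction (i j h : ℂ) : ModeAction i (RelaxedModule i j h) where
  E n := Algebra.lsmul ℂ ℂ _ (modeU H4.E n)
  F n := Algebra.lsmul ℂ ℂ _ (modeU H4.F n)
  I n := Algebra.lsmul ℂ ℂ _ (modeU H4.I n)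
  J n := Algebra.lsmul ℂ ℂ _ (modeU H4.J n)
  G := LinearMap.range (Induced.incl (DenseModule i j h))
  E_E m n x := by
    have h := Induced.modeU_smul_modeU_smul H4.E H4.E m n x
    rw [lie_self, modeU_zero, H4.form_E_E] at h
    simpa using h
  F_F m n x := by
    have h := Induced.modeU_smul_modeU_smul H4.F H4.F m n x
    rw [lie_self, modeU_zero, H4.form_F_F] at h
    simpa using h
  E_F m n x := by
    have h := Induced.modeU_smul_modeU_smul H4.E H4.F m n x
    rw [H4.lie_E_F, H4.form_E_F] at h
    simpa using h
  I_E m n x := by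
    have h := Induced.modeU_smul_modeU_smul H4.I H4.E m n x
    rw [H4.lie_I, modeU_zero, H4.form_I_E] at h
    simpa using h
  I_F m n x := by
    have h := Induced.modeU_smul_modeU_smul H4.I H4.F m n x
    rw [H4.lie_I, modeU_zero, H4.form_I_F] at h
    simpa using h
  I_I m n x := by
    have h := Induced.modeU_smul_modeU_smul H4.I H4.I m n x
    rw [H4.lie_I, modeU_zero, H4.form_I_I] at h
    simpa using h
  J_E m n x := by
    have h := Induced.modeU_smul_modeU_smul H4.J H4.E m n x
    rw [H4.lie_J_E, H4.form_J_E] at h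
    simpa using h
  J_F m n x := by
    have h := Induced.modeU_smul_modeU_smul H4.J H4.F m n x
    rw [H4.lie_J_F, modeU_neg, H4.form_J_F] at h
    simpa [sub_eq_add_neg] using h
  J_I m n x := by
    have h := Induced.modeU_smul_modeU_smul H4.J H4.I m n x
    rw [H4.lie_right_I, modeU_zero, H4.form_J_I] at h
    simpa using h
  J_J m n x := by
    have h := Induced.modeU_smul_modeU_smul H4.J H4.J m n x
    rw [lie_self, modeU_zero, H4.form_J_J] at h
    simpa using h
  I_zero := RelaxedModule.I_zero_smul
  E_pos n hn := by rintro _ ⟨m, rfl⟩; exact Induced.posMode_smul_incl _ hn m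
  F_pos n hn := by rintro _ ⟨m, rfl⟩; exact Induced.posMode_smul_incl _ hn m
  I_pos n hn := by rintro _ ⟨m, rfl⟩; exact Induced.posMode_smul_incl _ hn m
  J_pos n hn := by rintro _ ⟨m, rfl⟩; exact Induced.posMode_smul_incl _ hn m
  E_zero := by rintro _ ⟨m, rfl⟩; exact ⟨_, (Induced.zeroMode_smul_incl _ m).symm⟩
  F_zero := by rintro _ ⟨m, rfl⟩; exact ⟨_, (Induced.zeroMode_smul_incl _ m).symm⟩
  J_zero := by rintro _ ⟨m, rfl⟩; exact ⟨_, (Induced.zeroMode_smul_incl _ m).symm⟩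

theorem RelaxedModule.exists_mem_descendants (x : RelaxedModule i j h) :
    ∃ k d, x ∈ (modeAction i j h).descendants k d :=
  Induced.mem_of_modes (S := (modeAction i j h).allDescendants)
    (fun m => ⟨1, 0, .current (.ground ⟨m, rfl⟩)⟩)
    (fun n _ ⟨_, _, hx⟩ => ⟨_, _, (modeAction i j h).E_mem_descendants n hx⟩)
    (fun n _ ⟨_, _, hx⟩ => ⟨_, _, (modeAction i j h).F_mem_descendants n hx⟩)
    (fun n _ ⟨_, _, hx⟩ => ⟨_, _, (modeAction i j h).I_mem_descendants n hx⟩)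
    (fun n _ ⟨_, _, hx⟩ => ⟨_, _, (modeAction i j h).J_mem_descendants n hx⟩)
    (fun x hx => by rwa [Induced.centralU_smul]) x

/-- The copy of the dense module in `R_{i,j;h}` has minimal conformal weight: only the zero modes
contribute to `L₀` there. -/
theorem RelaxedModule.incl_mem_groundStates (m : DenseModule i j h) :
    Induced.incl _ m ∈ groundStates i j h := by
  have hpos (n : ℕ) : sugawaraTerm (n + 1) • Induced.incl _ m = 0 := by
    have hn : (0 : ℤ) < n + 1 := by omega
    simp only [sugawaraTerm, sub_smul, add_smul, mul_smul, Induced.posMode_smul_incl _ hn, smul_zero,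
      add_zero, sub_zero]
  have hQ : modeU H4.F 0 • modeU H4.E 0 • Induced.incl _ m
      + modeU H4.I 0 • modeU H4.J 0 • Induced.incl _ m = h • Induced.incl _ m := by
    simp only [Induced.zeroMode_smul_incl, ← map_add, ← map_smul, ← mul_smul, ← add_smul]
    rw [← DenseModule.casimir_smul, casimir]
  change virasoroZero _ = _
  rw [virasoroZero, finsum_eq_zero_of_forall_eq_zero hpos, add_zero, sugawaraZero, add_smul,
    add_smul, mul_smul, mul_smul, hQ, mul_smul, algebraMap_smul, algebraMap_smul, sub_smul,
    mul_smul, I_zero_smul, I_zero_smul, minimalWeight]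
  module

/-- For `i ∉ ℤ`, every nonzero submodule of `R_{i,j;h}` contains a nonzero ground state. -/
theorem groundFreeSubmodule_eq_bot (hi : ∀ n : ℤ, i ≠ n) : groundFreeSubmodule i j h = ⊥ := by
  refine sSup_eq_bot.2 fun N hN => (Submodule.eq_bot_iff N).2 fun x hx => ?_
  by_contra hx0
  obtain ⟨k, d, hkd⟩ := RelaxedModule.exists_mem_descendants x
  obtain ⟨_, hgN, ⟨m, rfl⟩, hg⟩ := (RelaxedModule.modeAction i j h).exists_mem_G hi
    (S := N.restrictScalars ℂ) (fun n _ y hy => N.smul_mem _ hy) (fun n _ y hy => N.smul_mem _ hy)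
    (fun n _ y hy => N.smul_mem _ hy) (fun n _ y hy => N.smul_mem _ hy) hkd hx hx0
  exact hg (hN _ hgN (RelaxedModule.incl_mem_groundStates m))

end Relaxed

end NappiWitten

end

/-- The first part is about `E⁺_{i;h}` and `R⁺_{i;h}`, the case `j ∈ h/i + ℤ_{>0}` in which `R̄_{i,j;h}`
has a highest-weight vector; the second part is about `E⁻_{i;h}` and `R⁻_{i;h}`, the case
`j ∈ h/i - ℤ_{≥0}` in which it has a lowest-weight vector. -/
theorem mainTheorem7 (i h : ℂ) (hi : ∀ n : ℤ, i ≠ (n : ℂ)) :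
    (∀ n : ℕ, Nonempty
      (NappiWitten.QuotientModule i (h / i + ((n : ℂ) + 1)) h ≃ₗ[NappiWitten.UAffine]
        NappiWitten.RelaxedModule i (h / i + ((n : ℂ) + 1)) h)) ∧
    (∀ n : ℕ, Nonempty
      (NappiWitten.QuotientModule i (h / i - (n : ℂ)) h ≃ₗ[NappiWitten.UAffine]
        NappiWitten.RelaxedModule i (h / i - (n : ℂ)) h)) :=
  ⟨fun _ => ⟨Submodule.quotEquivOfEqBot _ (NappiWitten.groundFreeSubmodule_eq_bot hi)⟩,
    fun _ => ⟨Submodule.quotEquivOfEqBot _ (NappiWitten.groundFreeSubmodule_eq_bot hi)⟩⟩
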